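/- Let $p\ge 0$ and let $(B_i,\mathbf A_i)_{i\ge 1}$ be i.i.d. random vectors, where $B_i\in\{-1,1\}$ and $\mathbf A_i=(A_{i1},\dots,A_{ip})^\top\in\{-1,1\}^p$; write $(B,\mathbf A)$ for a pair with their common law. For $a\in\{-1,1\}^p$ put $a^{\otimes}=(1,a_1)^\top\otimes\cdots\otimes(1,a_p)^\top\in\mathbb R^{2^p}$, let $H=\begin{pmatrix}1&1\\1&-1\end{pmatrix}^{\otimes p}$ be Sylvester's Hadamard matrix of size $2^p$, and let $v_1^\top,\dots,v_{2^p}^\top$ be its rows, which are the possible values of $a^\otimes$. Assume that $|E[B\mid \mathbf A]|<1$ almost surely and that $\beta\in\mathbb R^{2^p}$ is the unique vector with $E[B\mid \mathbf A]=\beta^\top \mathbf A^{\otimes}$ almost surely. Let $\mathcal A_n$ be the $n\times 2^p$ matrix with rows $(\mathbf A_i^{\otimes})^\top$, $1\le i\le n$, and let $\mathcal B_n=(B_1,\dots,B_n)^\top$. The least-squares estimator $\hat\beta=\hat\beta_n=(\mathcal A_n^\top\mathcal A_n)^{-1}\mathcal A_n^\top\mathcal B_n$ is said to exist if $\mathcal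 A_n^\top\mathcal A_n$ is invertible; where it does not exist, give $\hat\beta_n$ any values for which it is a measurable random vector. (1) Whenever $\hat\beta_n$ exists, it is the unique maximum likelihood estimator of the slopes with respect to the joint law of $(B,\mathbf A)$. That is, consider the likelihood $$L(q,b)=\prod_{i=1}^n q(\mathbf A_i)\,\frac{1+B_i\,b^\top \mathbf A_i^{\otimes}}{2},$$ where $q$ is a probability mass function on $\{-1,1\}^p$ and $b\in\mathbb R^{2^p}$ satisfies $\|Hb\|_\infty\le 1$. Then $L$ attains its maximum over all such pairs $(q,b)$, and every maximizer has $b=\hat\beta_n$. Likewise, $\hat\beta_n$ is the unique maximizer of $b\mapsto L(q,b)$ when $q$ is the true law of $\mathbf A$. (2) Almost surely, $\hat\beta_n$ exists for all sufficiently large $n$, and $\hat\beta_n\to\beta$ as $n\to\infty$. (3) As $n\to\infty$, $\sqrt n(\hat\beta_n-\beta)$ converges in distribution to $N\big(0,\,2^{-2p}HDH\big)$, where $$D=\mathrm{diag}\left(\frac{1-(\beta^\top v_i)^2}{P(\mathbf A^{\otimes}=v_i)}\right)_{i=1}^{2^p};$$ here $2^{-2p}HDH$ is positive semidefinite. In particular,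 all entries of $\hat\beta_n$ have the same asymptotic variance, $\mathrm{tr}(D)/2^{2p}$. -/

import Mathlib

open MeasureTheory ProbabilityTheory Filter Topology Matrix

noncomputable section

/-- The value set `{-1, 1}` is the type `ℤˣ`; this is the inclusion into `ℝ`. -/
def sgn (u : ℤˣ) : ℝ := ((u : ℤ) : ℝ)

/-- The `2 ^ p` positions of a `p`-fold Kronecker product of vectors of length two. -/
abbrev PowerIndex (p : ℕ) : Type := Fin p → Fin 2

/-- The power vector `(1, a₁)ᵀ ⊗ ⋯ ⊗ (1, aₚ)ᵀ`. -/
def powerVec {p : ℕ} (a : Fin p → ℤˣ) : PowerIndex p → ℝ :=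
  fun s => ∏ j, (![1, sgn (a j)] : Fin 2 → ℝ) (s j)

/-- Sylvester's Hadamard matrix of size `2 ^ p`: the `p`-fold Kronecker power
of `!![1, 1; 1, -1]`. -/
def sylvesterHadamard (p : ℕ) : Matrix (PowerIndex p) (PowerIndex p) ℝ :=
  Matrix.of fun s t => ∏ j, (!![1, 1; 1, -1] : Matrix (Fin 2) (Fin 2) ℝ) (s j) (t j)

/-- The `n × 2 ^ p` design matrix, whose rows are the power vectors of the observations. -/
def designMatrix {n p : ℕ} (a : Fin n → Fin p → ℤˣ) : Matrix (Fin n) (PowerIndex p) ℝ :=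
  Matrix.of fun i => powerVec (a i)

/-- The least-squares estimator exists when the Gram matrix of the design is invertible. -/
def LSEExists {n p : ℕ} (a : Fin n → Fin p → ℤˣ) : Prop :=
  IsUnit ((designMatrix a)ᵀ * designMatrix a)

/-- The least-squares estimator; meaningful only under `LSEExists a`. -/
def leastSquares {n p : ℕ} (a : Fin n → Fin p → ℤˣ) (y : Fin n → ℤˣ) : PowerIndex p → ℝ :=
  ((designMatrix a)ᵀ * designMatrix a)⁻¹ *ᵥ ((designMatrix a)ᵀ *ᵥ fun i => sgn (y i))

/-- The probability of `(B, A) = (r, v)` under the joint law with predictor marginal `q` and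
`E[B | A] = bᵀ A^⊗`. -/
def jointProb {p : ℕ} (q : (Fin p → ℤˣ) → ℝ) (b : PowerIndex p → ℝ)
    (r : ℤˣ) (v : Fin p → ℤˣ) : ℝ :=
  q v * ((1 + sgn r * (b ⬝ᵥ powerVec v)) / 2)

/-- The likelihood of a sample of `(B, A)`. -/
def likelihood {n p : ℕ} (a : Fin n → Fin p → ℤˣ) (y : Fin n → ℤˣ)
    (q : (Fin p → ℤˣ) → ℝ) (b : PowerIndex p → ℝ) : ℝ :=
  ∏ i, jointProb q b (y i) (a i)

/-- The slope vectors that define conditional probabilities in `[0, 1]`. -/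
def slopeSpace (p : ℕ) : Set (PowerIndex p → ℝ) :=
  {b | ∀ v : Fin p → ℤˣ, |b ⬝ᵥ powerVec v| ≤ 1}

/-- `b` is the slope component of a maximum likelihood estimate `(q, b)` of the joint law of
`(B, A)`, the marginal law `q` of the predictors being unknown. -/
def IsMLE {n p : ℕ} (a : Fin n → Fin p → ℤˣ) (y : Fin n → ℤˣ)
    (b : PowerIndex p → ℝ) : Prop :=
  ∃ q ∈ stdSimplex ℝ (Fin p → ℤˣ), b ∈ slopeSpace p ∧
    ∀ q' ∈ stdSimplex ℝ (Fin p → ℤˣ), ∀ b' ∈ slopeSpace p,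
      likelihood a y q' b' ≤ likelihood a y q b

/-- `b` is a maximum likelihood estimate of the slopes in the joint law of `(B, A)`, the marginal
law `q` of the predictors being known. -/
def IsMLEKnownMarginal {n p : ℕ} (q : (Fin p → ℤˣ) → ℝ) (a : Fin n → Fin p → ℤˣ)
    (y : Fin n → ℤˣ) (b : PowerIndex p → ℝ) : Prop :=
  b ∈ slopeSpace p ∧ ∀ b' ∈ slopeSpace p, likelihood a y q b' ≤ likelihood a y q b

/-- `E[B | A] = bᵀ A^⊗` almost surely. -/
def IsSlopeVector {Ω : Type*} [MeasurableSpace Ω] (P : Measure Ω) {p : ℕ}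
    (A : Ω → Fin p → ℤˣ) (B : Ω → ℤˣ) (b : PowerIndex p → ℝ) : Prop :=
  P[fun ω => sgn (B ω) | MeasurableSpace.comap A inferInstance]
    =ᵐ[P] fun ω => b ⬝ᵥ powerVec (A ω)

/-- The diagonal matrix with entries `(1 - (βᵀ vₛ)²) / P(A^⊗ = vₛ)`, where `vₛ` is the row of
index `s` of the Hadamard matrix. -/
def cellVarMatrix {Ω : Type*} [MeasurableSpace Ω] (P : Measure Ω) {p : ℕ}
    (A : Ω → Fin p → ℤˣ) (β : PowerIndex p → ℝ) : Matrix (PowerIndex p) (PowerIndex p) ℝ :=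
  Matrix.diagonal fun s =>
    (1 - (β ⬝ᵥ sylvesterHadamard p s) ^ 2) /
      P.real {ω | powerVec (A ω) = sylvesterHadamard p s}

/-- The asymptotic covariance matrix `2 ^ (-2p) H D H`. -/
def asymptoticCov {Ω : Type*} [MeasurableSpace Ω] (P : Measure Ω) {p : ℕ}
    (A : Ω → Fin p → ℤˣ) (β : PowerIndex p → ℝ) : Matrix (PowerIndex p) (PowerIndex p) ℝ :=
  (1 / (2 : ℝ) ^ (2 * p)) •
    (sylvesterHadamard p * cellVarMatrix P A β * sylvesterHadamard p)

end

/-! The power vectors are an orthogonal family of `2 ^ p` vectors of squared norm `2 ^ p`, so `b`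
and its cell values `b ⬝ᵥ powerVec v` determine each other linearly: the regression is a saturated
model. Hence the least-squares estimator exists exactly when every cell is occupied
(`lseExists_iff`), and its cell values are the cell means of the responses
(`cellCount_mul_leastSquares`).

Together with the empirical marginal it therefore reproduces the empirical law of `(B, A)`
(`jointProb_leastSquares`). That law is the unique likelihood maximizer among all mass functions
(`prod_le_prod_empiricalMass`), a fortiori within the model. A known positive marginal only
multiplies the likelihood by a constant.

Uniqueness of `β` forces every cell to have positive probability (`measureReal_cell_pos`), so the
strong law gives existence for large `n` and consistency cell by cell. For the limit law, the scaled
error is a normalized i.i.d. sum whose cell values are multiplied by ratios tending to one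
(`sqrt_smul_leastSquares_sub`). The central limit theorem and Slutsky's theorem finish. The limit
covariance is diagonal in cell coordinates because an observation falls in only one cell. -/

noncomputable section

/-! ### Orthogonality of the power vectors and the Hadamard matrix -/

section Algebra

variable {p : ℕ}

lemma sgn_one : sgn 1 = 1 := by simp [sgn]

lemma sgn_neg_one : sgn (-1) = -1 := by simp [sgn]

lemma sgn_mul_self (u : ℤˣ) : sgn u * sgn u = 1 := by
  rcases Int.units_eq_one_or u with rfl | rfl <;> simp [sgn]

lemma sum_units_int {M : Type*} [AddCommMonoid M] (f : ℤˣ → M) : ∑ u, f u = f 1 + f (-1) := by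
  rw [show (Finset.univ : Finset ℤˣ) = {1, -1} from rfl, Finset.sum_pair (by decide)]

/-- Inner products of Kronecker products factor over the coordinates; a coordinate where the signs
differ contributes `1 - 1 = 0`. -/
lemma powerVec_dotProduct_powerVec (v w : Fin p → ℤˣ) :
    powerVec v ⬝ᵥ powerVec w = if v = w then (2 : ℝ) ^ p else 0 := by
  have h : powerVec v ⬝ᵥ powerVec w = ∏ j, (1 + sgn (v j) * sgn (w j)) := by
    simp_rw [dotProduct, powerVec, ← Finset.prod_mul_distrib]
    rw [← Fintype.piFinset_univ,
      ← Finset.prod_univ_sum (fun _ : Fin p => (Finset.univ : Finset (Fin 2)))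
      (fun j k => (![1, sgn (v j)] : Fin 2 → ℝ) k * (![1, sgn (w j)] : Fin 2 → ℝ) k)]
    simp
  rw [h]
  split_ifs with hvw
  · subst hvw
    simp [sgn_mul_self, one_add_one_eq_two]
  · obtain ⟨j, hj⟩ := Function.ne_iff.1 hvw
    refine Finset.prod_eq_zero (Finset.mem_univ j) ?_
    rcases Int.units_eq_one_or (v j) with h1 | h1 <;>
      rcases Int.units_eq_one_or (w j) with h2 | h2 <;> simp_all [sgn]

/-- The dual orthogonality, between positions rather than cells; it yields the inversion formula for
cell values. -/
lemma sum_powerVec_mul_powerVec (s t : PowerIndex p) :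
    ∑ v : Fin p → ℤˣ, powerVec v s * powerVec v t = if s = t then (2 : ℝ) ^ p else 0 := by
  have h : ∑ v : Fin p → ℤˣ, powerVec v s * powerVec v t =
      ∏ j, ∑ u : ℤˣ, (![1, sgn u] : Fin 2 → ℝ) (s j) * (![1, sgn u] : Fin 2 → ℝ) (t j) := by
    simp_rw [powerVec, ← Finset.prod_mul_distrib]
    rw [← Fintype.piFinset_univ,
      ← Finset.prod_univ_sum (fun _ : Fin p => (Finset.univ : Finset ℤˣ))
      (fun j u => (![1, sgn u] : Fin 2 → ℝ) (s j) * (![1, sgn u] : Fin 2 → ℝ) (t j))]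
  rw [h]
  simp_rw [sum_units_int]
  split_ifs with hst
  · subst hst
    have : ∀ k : Fin 2, (![1, sgn 1] : Fin 2 → ℝ) k * (![1, sgn 1] : Fin 2 → ℝ) k +
        (![1, sgn (-1)] : Fin 2 → ℝ) k * (![1, sgn (-1)] : Fin 2 → ℝ) k = 2 := by
      intro k
      fin_cases k <;> norm_num [sgn]
    simp [this]
  · obtain ⟨j, hj⟩ := Function.ne_iff.1 hst
    refine Finset.prod_eq_zero (Finset.mem_univ j) ?_
    generalize s j = k at *
    generalize t j = l at *
    fin_cases k <;> fin_cases l <;> simp_all [sgn]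

/-- A vector is recovered from its products with the power vectors. -/
lemma sum_dotProduct_smul_powerVec (b : PowerIndex p → ℝ) :
    ((2 : ℝ) ^ p)⁻¹ • ∑ v : Fin p → ℤˣ, (b ⬝ᵥ powerVec v) • powerVec v = b := by
  ext t
  simp only [Pi.smul_apply, Finset.sum_apply, smul_eq_mul, dotProduct, Finset.sum_mul]
  rw [Finset.sum_comm]
  simp_rw [mul_assoc, ← Finset.mul_sum, sum_powerVec_mul_powerVec]
  simp [mul_comm (b t)]

lemma ext_dotProduct_powerVec {b c : PowerIndex p → ℝ}
    (h : ∀ v, b ⬝ᵥ powerVec v = c ⬝ᵥ powerVec v) : b = c := by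
  rw [← sum_dotProduct_smul_powerVec b, ← sum_dotProduct_smul_powerVec c]
  simp_rw [h]

lemma dotProduct_sum_smul_powerVec (c : (Fin p → ℤˣ) → ℝ) (v : Fin p → ℤˣ) :
    (∑ w, c w • powerVec w) ⬝ᵥ powerVec v = 2 ^ p * c v := by
  simp [sum_dotProduct, smul_dotProduct, powerVec_dotProduct_powerVec, mul_comm]

lemma powerVec_injective : Function.Injective (powerVec : (Fin p → ℤˣ) → PowerIndex p → ℝ) := by
  intro v w h
  by_contra hne
  have h1 := powerVec_dotProduct_powerVec v w
  rw [if_neg hne, h, powerVec_dotProduct_powerVec, if_pos rfl] at h1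
  exact absurd h1 (by positivity)

/-- The correspondence between the positions `0, 1` and the signs `1, -1`. -/
def rowEquiv (p : ℕ) : PowerIndex p ≃ (Fin p → ℤˣ) :=
  Equiv.piCongrRight fun _ =>
    { toFun := fun k => if k = 0 then 1 else -1
      invFun := fun u => if u = 1 then 0 else 1
      left_inv := by decide
      right_inv := by decide }

lemma sylvesterHadamard_row (s : PowerIndex p) :
    sylvesterHadamard p s = powerVec (rowEquiv p s) := by
  ext t
  simp only [sylvesterHadamard, powerVec, Matrix.of_apply]
  refine Finset.prod_congr rfl fun j _ => ?_
  have : rowEquiv p s j = if s j = 0 then 1 else -1 := rfl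
  rw [this]
  generalize s j = k
  generalize t j = l
  fin_cases k <;> fin_cases l <;> simp [sgn]

lemma sylvesterHadamard_transpose : (sylvesterHadamard p)ᵀ = sylvesterHadamard p := by
  ext s t
  simp only [sylvesterHadamard, Matrix.of_apply, transpose_apply]
  refine Finset.prod_congr rfl fun j _ => ?_
  generalize s j = k
  generalize t j = l
  fin_cases k <;> fin_cases l <;> simp

lemma sylvesterHadamard_mul_self (s t : PowerIndex p) :
    sylvesterHadamard p s t * sylvesterHadamard p s t = 1 := by
  simp only [sylvesterHadamard, Matrix.of_apply, ← Finset.prod_mul_distrib]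
  refine Finset.prod_eq_one fun j _ => ?_
  generalize s j = k
  generalize t j = l
  fin_cases k <;> fin_cases l <;> simp

end Algebra

/-! ### Least squares as cell means -/

section Sample

variable {n p : ℕ}

/-- The number of observations in the cell `v`. -/
def cellCount (a : Fin n → Fin p → ℤˣ) (v : Fin p → ℤˣ) : ℝ := ∑ i, if a i = v then 1 else 0

/-- The sum of the responses over the cell `v`. -/
def cellSum (a : Fin n → Fin p → ℤˣ) (y : Fin n → ℤˣ) (v : Fin p → ℤˣ) : ℝ :=
  ∑ i, if a i = v then sgn (y i) else 0

lemma cellCount_nonneg (a : Fin n → Fin p → ℤˣ) (v : Fin p → ℤˣ) : 0 ≤ cellCount a v :=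
  Finset.sum_nonneg fun i _ => by split_ifs <;> norm_num

lemma cellCount_pos_iff (a : Fin n → Fin p → ℤˣ) (v : Fin p → ℤˣ) :
    0 < cellCount a v ↔ ∃ i, a i = v := by
  simp only [cellCount, Finset.sum_boole, Nat.cast_pos, Finset.card_pos]
  simp [Finset.Nonempty]

lemma designMatrix_mulVec (a : Fin n → Fin p → ℤˣ) (b : PowerIndex p → ℝ) (i : Fin n) :
    (designMatrix a *ᵥ b) i = b ⬝ᵥ powerVec (a i) :=
  dotProduct_comm _ _

/-- The power vector of an empty cell is orthogonal to every row of the design, so it lies in the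
kernel. Conversely, a kernel vector of the Gram matrix has zero value in every occupied cell. -/
lemma lseExists_iff (a : Fin n → Fin p → ℤˣ) : LSEExists a ↔ ∀ v, 0 < cellCount a v := by
  simp only [cellCount_pos_iff, LSEExists]
  have hinj := Matrix.mulVec_injective_iff_isUnit (A := (designMatrix a)ᵀ * designMatrix a)
  rw [← hinj]
  constructor
  · intro h v
    by_contra! hv
    have h0 : designMatrix a *ᵥ powerVec v = 0 := by
      ext i
      rw [designMatrix_mulVec, powerVec_dotProduct_powerVec, if_neg (hv i).symm, Pi.zero_apply]
    have h1 : powerVec v = 0 := h (by simp only [← mulVec_mulVec, h0, mulVec_zero])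
    have h2 := powerVec_dotProduct_powerVec v v
    rw [h1, zero_dotProduct, if_pos rfl] at h2
    exact absurd h2 (by positivity)
  · intro h
    refine (injective_iff_map_eq_zero
      (Matrix.mulVecLin ((designMatrix a)ᵀ * designMatrix a))).2 fun b hb => ?_
    rw [mulVecLin_apply, ← mulVec_mulVec] at hb
    have h1 : (designMatrix a *ᵥ b) ⬝ᵥ (designMatrix a *ᵥ b) = 0 := by
      rw [dotProduct_mulVec, ← mulVec_transpose, hb, zero_dotProduct]
    rw [dotProduct_self_eq_zero] at h1
    refine ext_dotProduct_powerVec fun v => ?_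
    obtain ⟨i, rfl⟩ := h v
    rw [← designMatrix_mulVec, h1]
    simp

/-- The least-squares fit in each cell is the mean response. -/
lemma cellCount_mul_leastSquares {a : Fin n → Fin p → ℤˣ} (ha : LSEExists a) (y : Fin n → ℤˣ)
    (v : Fin p → ℤˣ) :
    cellCount a v * (leastSquares a y ⬝ᵥ powerVec v) = cellSum a y v := by
  set b := leastSquares a y with hb
  have hnormal : (designMatrix a)ᵀ *ᵥ (designMatrix a *ᵥ b) =
      (designMatrix a)ᵀ *ᵥ fun i => sgn (y i) := by
    rw [mulVec_mulVec, hb, leastSquares, mulVec_mulVec,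
      Matrix.mul_nonsing_inv _ ((Matrix.isUnit_iff_isUnit_det _).1 ha), one_mulVec]
  -- The normal equations with observations grouped by cell; orthogonality then makes each
  -- coefficient vanish.
  have hsum : ∑ w, (cellCount a w * (b ⬝ᵥ powerVec w) - cellSum a y w) • powerVec w = 0 := by
    ext s
    have h1 := congrFun hnormal s
    simp only [mulVec, dotProduct, transpose_apply] at h1
    have h2 : ∀ i, ∑ t, designMatrix a i t * b t = b ⬝ᵥ powerVec (a i) :=
      designMatrix_mulVec a b
    simp only [h2] at h1
    rw [← sub_eq_zero, ← Finset.sum_sub_distrib] at h1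
    simp only [Finset.sum_apply, Pi.smul_apply, smul_eq_mul, Pi.zero_apply, cellCount, cellSum,
      Finset.sum_mul, ← Finset.sum_sub_distrib]
    rw [Finset.sum_comm]
    refine (Finset.sum_congr rfl fun i _ => ?_).trans h1
    rw [Finset.sum_eq_single (a i)]
    · simp [designMatrix]; ring
    · intro w _ hw
      simp [hw.symm]
    · simp
  have h := dotProduct_sum_smul_powerVec
    (fun w => cellCount a w * (b ⬝ᵥ powerVec w) - cellSum a y w) v
  rw [hsum, zero_dotProduct, eq_comm, mul_eq_zero] at h
  rcases h with h | h
  · exact absurd h (by positivity)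
  · linarith

end Sample

/-! ### Maximum likelihood -/

section Likelihood

/-- Multiply the bounds `x ≤ exp (x - 1)`, which are strict unless `x = 1`. Applied to likelihood
ratios, this is Gibbs' inequality with its equality case. -/
lemma prod_le_one_of_sum_le_card {ι : Type*} [Fintype ι] {r : ι → ℝ} (h0 : ∀ i, 0 ≤ r i)
    (hs : ∑ i, r i ≤ Fintype.card ι) : ∏ i, r i ≤ 1 ∧ (∏ i, r i = 1 → ∀ i, r i = 1) := by
  have hexp : ∏ i, Real.exp (r i - 1) ≤ 1 := by
    rw [← Real.exp_sum, Real.exp_le_one_iff, Finset.sum_sub_distrib]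
    simpa using hs
  have hle : ∀ i, r i ≤ Real.exp (r i - 1) := fun i => by linarith [Real.add_one_le_exp (r i - 1)]
  refine ⟨(Finset.prod_le_prod (fun i _ => h0 i) fun i _ => hle i).trans hexp, fun h1 => ?_⟩
  by_contra! hne
  obtain ⟨j, hj⟩ := hne
  have hpos : ∀ i, 0 < r i := fun i => (h0 i).lt_of_ne' fun h =>
    zero_ne_one ((Finset.prod_eq_zero (Finset.mem_univ i) h).symm.trans h1)
  have := Finset.prod_lt_prod (s := Finset.univ) (fun i _ => hpos i) (fun i _ => hle i)
    ⟨j, Finset.mem_univ j, by linarith [Real.add_one_lt_exp (sub_ne_zero.2 hj)]⟩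
  linarith

variable {κ : Type*} [DecidableEq κ] {n : ℕ}

/-- The relative frequencies of a sample. -/
def empiricalMass (x : Fin n → κ) (k : κ) : ℝ := (∑ i, if x i = k then 1 else 0) / n

lemma empiricalMass_pos (x : Fin n → κ) (i : Fin n) : 0 < empiricalMass x (x i) := by
  have hn : (0 : ℝ) < n := by exact_mod_cast i.pos
  refine div_pos (Finset.sum_pos' (fun j _ => by split_ifs <;> norm_num) ⟨i, by simp, by simp⟩) hn

lemma empiricalMass_eq_zero {x : Fin n → κ} {k : κ} (h : ∀ i, x i ≠ k) :
    empiricalMass x k = 0 := by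
  simp [empiricalMass, h]

lemma empiricalMass_nonneg (x : Fin n → κ) (k : κ) : 0 ≤ empiricalMass x k :=
  div_nonneg (Finset.sum_nonneg fun j _ => by split_ifs <;> norm_num) (Nat.cast_nonneg _)

variable [Fintype κ]

lemma sum_empiricalMass [NeZero n] (x : Fin n → κ) : ∑ k, empiricalMass x k = 1 := by
  have hn : (n : ℝ) ≠ 0 := Nat.cast_ne_zero.2 (NeZero.ne n)
  simp_rw [empiricalMass, ← Finset.sum_div]
  rw [Finset.sum_comm]
  simp [hn]

/-- The empirical distribution is the unique maximizer of the likelihood over all probability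
mass functions. -/
lemma prod_le_prod_empiricalMass (x : Fin n → κ) {g : κ → ℝ} (hg : g ∈ stdSimplex ℝ κ) :
    ∏ i, g (x i) ≤ ∏ i, empiricalMass x (x i) ∧
      (0 < n → ∏ i, g (x i) = ∏ i, empiricalMass x (x i) → g = empiricalMass x) := by
  have hpos : 0 < ∏ i, empiricalMass x (x i) := Finset.prod_pos fun i _ => empiricalMass_pos x i
  have hratio : ∑ i, g (x i) / empiricalMass x (x i) ≤ (Fintype.card (Fin n) : ℝ) := by
    have h1 : ∑ i, g (x i) / empiricalMass x (x i) =
        ∑ k, n * empiricalMass x k * (g k / empiricalMass x k) := by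
      have : ∀ k, (n : ℝ) * empiricalMass x k = ∑ i, if x i = k then 1 else 0 := by
        intro k
        rcases Nat.eq_zero_or_pos n with rfl | hn
        · simp
        · rw [empiricalMass, mul_div_cancel₀ _ (by positivity)]
      simp_rw [this, Finset.sum_mul]
      rw [Finset.sum_comm]
      simp
    rw [h1, Fintype.card_fin]
    calc ∑ k, n * empiricalMass x k * (g k / empiricalMass x k)
        ≤ ∑ k, n * g k := by
          -- Unobserved values contribute zero on the left, since division by zero gives zero.
          refine Finset.sum_le_sum fun k _ => ?_
          rw [mul_assoc]
          refine mul_le_mul_of_nonneg_left ?_ (Nat.cast_nonneg _)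
          rcases eq_or_ne (empiricalMass x k) 0 with h | h
          · simp [h, hg.1 k]
          · rw [mul_div_cancel₀ _ h]
      _ = n := by rw [← Finset.mul_sum, hg.2, mul_one]
  obtain ⟨hle, heq⟩ := prod_le_one_of_sum_le_card
    (fun i => div_nonneg (hg.1 (x i)) (empiricalMass_nonneg x _)) hratio
  rw [Finset.prod_div_distrib] at hle heq
  refine ⟨(div_le_one hpos).1 hle, fun hn h => ?_⟩
  have : NeZero n := ⟨hn.ne'⟩
  have h1 := heq (by rw [h, div_self hpos.ne'])
  have h2 : ∀ i, g (x i) = empiricalMass x (x i) := fun i =>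
    (div_eq_one_iff_eq (empiricalMass_pos x i).ne').1 (h1 i)
  -- Equality of the products only gives agreement at observed values. Elsewhere the empirical mass
  -- is zero, and equal total mass upgrades the inequality to equality.
  have h3 : ∀ k, empiricalMass x k ≤ g k := by
    intro k
    by_cases hk : ∃ i, x i = k
    · obtain ⟨i, rfl⟩ := hk
      exact (h2 i).ge
    · rw [empiricalMass_eq_zero (not_exists.1 hk)]
      exact hg.1 k
  have h4 := (Finset.sum_eq_sum_iff_of_le fun k (_ : k ∈ Finset.univ) => h3 k).1
    ((sum_empiricalMass x).trans hg.2.symm)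
  exact funext fun k => (h4 k (Finset.mem_univ k)).symm

variable {p : ℕ}

lemma jointProb_mem_stdSimplex {q : (Fin p → ℤˣ) → ℝ} (hq : q ∈ stdSimplex ℝ (Fin p → ℤˣ))
    {b : PowerIndex p → ℝ} (hb : b ∈ slopeSpace p) :
    (fun x : ℤˣ × (Fin p → ℤˣ) => jointProb q b x.1 x.2) ∈ stdSimplex ℝ _ := by
  constructor
  · rintro ⟨r, v⟩
    have := abs_le.1 (hb v)
    refine mul_nonneg (hq.1 v) (div_nonneg ?_ zero_le_two)
    rcases Int.units_eq_one_or r with rfl | rfl <;> simp only [sgn_one, sgn_neg_one] <;> linarith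
  · rw [Fintype.sum_prod_type, sum_units_int, ← Finset.sum_add_distrib, ← hq.2]
    refine Finset.sum_congr rfl fun v _ => ?_
    simp only [jointProb, sgn_one, sgn_neg_one]
    ring

/-- Summing over the two responses recovers the marginal, which can then be cancelled. -/
lemma jointProb_eq_iff {q q' : (Fin p → ℤˣ) → ℝ} {b b' : PowerIndex p → ℝ} {v : Fin p → ℤˣ}
    (hq : q v ≠ 0) (h : ∀ r, jointProb q b r v = jointProb q' b' r v) :
    b ⬝ᵥ powerVec v = b' ⬝ᵥ powerVec v := by
  have h1 := h 1
  have h2 := h (-1)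
  simp only [jointProb, sgn_one, sgn_neg_one] at h1 h2
  have hqq : q v = q' v := by linarith
  rw [← hqq] at h1
  have := mul_left_cancel₀ hq h1
  linarith

/-- Saturation: in cell `v` the response `r` occurs `(cellCount + sgn r * cellSum) / 2` times, and
`cellSum` is the count times the fitted value. -/
lemma jointProb_leastSquares {a : Fin n → Fin p → ℤˣ} (ha : LSEExists a) (y : Fin n → ℤˣ)
    (r : ℤˣ) (v : Fin p → ℤˣ) :
    jointProb (empiricalMass a) (leastSquares a y) r v =
      empiricalMass (fun i => (y i, a i)) (r, v) := by
  have h := cellCount_mul_leastSquares ha y v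
  have h' : empiricalMass a v = cellCount a v / n := rfl
  have h2 : (∑ i, if (y i, a i) = (r, v) then (1 : ℝ) else 0) =
      (cellCount a v + sgn r * cellSum a y v) / 2 := by
    rw [cellCount, cellSum, Finset.mul_sum, ← Finset.sum_add_distrib, Finset.sum_div]
    refine Finset.sum_congr rfl fun i _ => ?_
    rcases Int.units_eq_one_or r with rfl | rfl <;>
      rcases Int.units_eq_one_or (y i) with hy | hy <;> by_cases hv : a i = v <;>
      simp [hy, hv, sgn]
  rw [jointProb, h', empiricalMass, h2, ← h]
  ring

lemma leastSquares_mem_slopeSpace {a : Fin n → Fin p → ℤˣ} (ha : LSEExists a) (y : Fin n → ℤˣ) :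
    leastSquares a y ∈ slopeSpace p := by
  intro v
  have hpos := (lseExists_iff a).1 ha v
  have hle : |cellSum a y v| ≤ cellCount a v := by
    refine (Finset.abs_sum_le_sum_abs _ _).trans (Finset.sum_le_sum fun i _ => ?_)
    rcases Int.units_eq_one_or (y i) with hy | hy <;> split_ifs <;> simp [hy, sgn]
  rw [← cellCount_mul_leastSquares ha y v, abs_mul, abs_of_pos hpos] at hle
  exact le_of_mul_le_mul_left (by simpa using hle) hpos

lemma pos_of_lseExists {a : Fin n → Fin p → ℤˣ} (ha : LSEExists a) : 0 < n := by
  obtain ⟨i, -⟩ := (cellCount_pos_iff a 1).1 ((lseExists_iff a).1 ha 1)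
  exact i.pos

lemma empiricalMass_mem_stdSimplex (hn : 0 < n) (x : Fin n → κ) :
    empiricalMass x ∈ stdSimplex ℝ κ :=
  have : NeZero n := ⟨hn.ne'⟩
  ⟨empiricalMass_nonneg x, sum_empiricalMass x⟩

lemma likelihood_le_leastSquares {a : Fin n → Fin p → ℤˣ} (ha : LSEExists a) (y : Fin n → ℤˣ)
    {q : (Fin p → ℤˣ) → ℝ} (hq : q ∈ stdSimplex ℝ (Fin p → ℤˣ))
    {b : PowerIndex p → ℝ} (hb : b ∈ slopeSpace p) :
    likelihood a y q b ≤ likelihood a y (empiricalMass a) (leastSquares a y) ∧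
      (likelihood a y q b = likelihood a y (empiricalMass a) (leastSquares a y) →
        b = leastSquares a y) := by
  obtain ⟨hle, heq⟩ := prod_le_prod_empiricalMass (fun i => (y i, a i))
    (jointProb_mem_stdSimplex hq hb)
  simp only [← jointProb_leastSquares ha] at hle heq
  refine ⟨hle, fun h => ?_⟩
  have h1 := heq (pos_of_lseExists ha) h
  refine ext_dotProduct_powerVec fun v => (jointProb_eq_iff (q := empiricalMass a) (q' := q) ?_
    fun r => ?_).symm
  · obtain ⟨i, rfl⟩ := (cellCount_pos_iff a v).1 ((lseExists_iff a).1 ha v)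
    exact (empiricalMass_pos a i).ne'
  · rw [jointProb_leastSquares ha]
    exact (congrFun h1 (r, v)).symm

lemma isMLE_iff {a : Fin n → Fin p → ℤˣ} (ha : LSEExists a) (y : Fin n → ℤˣ)
    (b : PowerIndex p → ℝ) : IsMLE a y b ↔ b = leastSquares a y := by
  have hmem := empiricalMass_mem_stdSimplex (pos_of_lseExists ha) a
  constructor
  · rintro ⟨q, hq, hb, hmax⟩
    obtain ⟨hle, heq⟩ := likelihood_le_leastSquares ha y hq hb
    exact heq (le_antisymm hle (hmax _ hmem _ (leastSquares_mem_slopeSpace ha y)))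
  · rintro rfl
    exact ⟨_, hmem, leastSquares_mem_slopeSpace ha y,
      fun q hq b hb => (likelihood_le_leastSquares ha y hq hb).1⟩

lemma likelihood_eq_mul (a : Fin n → Fin p → ℤˣ) (y : Fin n → ℤˣ) (q : (Fin p → ℤˣ) → ℝ)
    (b : PowerIndex p → ℝ) :
    likelihood a y q b =
      (∏ i, q (a i)) * ∏ i, (1 + sgn (y i) * (b ⬝ᵥ powerVec (a i))) / 2 := by
  simp only [likelihood, jointProb, Finset.prod_mul_distrib]

lemma isMLEKnownMarginal_iff {q : (Fin p → ℤˣ) → ℝ} (hq : ∀ v, 0 < q v)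
    {a : Fin n → Fin p → ℤˣ} (ha : LSEExists a) (y : Fin n → ℤˣ)
    (b : PowerIndex p → ℝ) : IsMLEKnownMarginal q a y b ↔ b = leastSquares a y := by
  have hmem := empiricalMass_mem_stdSimplex (pos_of_lseExists ha) a
  have hQ : 0 < ∏ i, q (a i) := Finset.prod_pos fun i _ => hq _
  have hE : 0 < ∏ i, empiricalMass a (a i) := Finset.prod_pos fun i _ => empiricalMass_pos a i
  -- The marginal enters as a positive factor free of the slopes, so it may be exchanged for the
  -- empirical one.
  have hcmp : ∀ b c, likelihood a y q b ≤ likelihood a y q c ↔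
      likelihood a y (empiricalMass a) b ≤ likelihood a y (empiricalMass a) c := by
    intro b c
    simp only [likelihood_eq_mul, mul_le_mul_iff_right₀ hQ, mul_le_mul_iff_right₀ hE]
  simp only [IsMLEKnownMarginal, hcmp]
  constructor
  · rintro ⟨hb, hmax⟩
    obtain ⟨hle, heq⟩ := likelihood_le_leastSquares ha y hmem hb
    exact heq (le_antisymm hle (hmax _ (leastSquares_mem_slopeSpace ha y)))
  · rintro rfl
    exact ⟨leastSquares_mem_slopeSpace ha y,
      fun b hb => (likelihood_le_leastSquares ha y hmem hb).1⟩

end Likelihood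

/-! ### Central limit theorem by the Cramér–Wold device -/

section MultivariateCLT

variable {Ω ι : Type*} [MeasurableSpace Ω] {P : Measure Ω}

lemma charFun_map_eq_charFun_map_inner {E : Type*} [NormedAddCommGroup E] [InnerProductSpace ℝ E]
    [MeasurableSpace E] [BorelSpace E] [SecondCountableTopology E]
    {X : Ω → E} (hX : AEMeasurable X P) (t : E) :
    charFun (P.map X) t = charFun (P.map fun ω => inner ℝ (X ω) t) 1 := by
  have h1 : AEMeasurable (fun ω => inner ℝ (X ω) t) P := hX.inner_const
  rw [charFun_apply, charFun_apply_real, integral_map hX (by fun_prop),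
    integral_map h1 (by fun_prop)]
  simp

variable [IsProbabilityMeasure P] [Fintype ι] [DecidableEq ι]

/-- The central limit theorem in `ℝ ^ ι` for centered random vectors. -/
theorem tendstoInDistribution_multivariateGaussian {X : ℕ → Ω → EuclideanSpace ℝ ι}
    (hindep : iIndepFun X P) (hident : ∀ i, IdentDistrib (X i) (X 0) P P)
    (hX : MemLp (X 0) 2 P) {S : Matrix ι ι ℝ} (hS : S.PosSemidef)
    (hmean : ∀ t, ∫ ω, inner ℝ (X 0 ω) t ∂P = 0)
    (hvar : ∀ t : EuclideanSpace ℝ ι, ∫ ω, inner ℝ (X 0 ω) t ^ 2 ∂P = t ⬝ᵥ S *ᵥ t) :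
    TendstoInDistribution (fun (n : ℕ) ω => (√(n : ℝ))⁻¹ • ∑ k ∈ Finset.range n, X k ω)
      atTop id (fun _ => P) (multivariateGaussian 0 S) := by
  have hXm : ∀ i, AEMeasurable (X i) P := fun i => (hident i).aemeasurable_fst
  have hSm : ∀ n : ℕ,
      AEMeasurable (fun ω => (√(n : ℝ))⁻¹ • ∑ k ∈ Finset.range n, X k ω) P := fun n =>
    AEMeasurable.fun_const_smul (Finset.aemeasurable_fun_sum _ fun i _ => hXm i) _
  refine ⟨hSm, aemeasurable_id, ?_⟩
  refine ProbabilityMeasure.tendsto_iff_tendsto_charFun.2 fun t => ?_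
  have hmeas : Measurable fun x : EuclideanSpace ℝ ι => inner ℝ x t := by fun_prop
  have hmem : MemLp (fun ω => inner ℝ (X 0 ω) t) 2 P := hX.inner_const t
  have hv : Var[fun ω => inner ℝ (X 0 ω) t; P] = t ⬝ᵥ S *ᵥ t := by
    rw [variance_of_integral_eq_zero hmem.aemeasurable (hmean t), hvar]
  have hclt := tendstoInDistribution_inv_sqrt_mul_sum_sub
    (X := fun i ω => inner ℝ (X i ω) t) HasLaw.id hmem
    (hindep.comp (fun _ x => inner ℝ x t) fun _ => hmeas)
    (fun i => (hident i).comp hmeas)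
  -- The characteristic function at `t` is that of the projection onto `t` at frequency `1`.
  have hlim := ProbabilityMeasure.tendsto_iff_tendsto_charFun.1 hclt.tendsto 1
  simp only [ProbabilityMeasure.coe_mk, Measure.map_id, charFun_gaussianReal, hv, hmean,
    mul_zero, sub_zero] at hlim
  simp only [ProbabilityMeasure.coe_mk, Measure.map_id, charFun_multivariateGaussian hS]
  have hnn : 0 ≤ t ⬝ᵥ S *ᵥ t := hv ▸ variance_nonneg _ _
  convert hlim using 2 with n
  · rw [charFun_map_eq_charFun_map_inner (hSm n)]
    simp only [real_inner_smul_left, sum_inner]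
  · simp [Real.coe_toNNReal _ hnn]

end MultivariateCLT

instance : MeasurableSingletonClass ℤˣ where
  measurableSet_singleton u := ⟨{(u : ℤ)}, measurableSet_singleton _, by ext; simp [Units.ext_iff]⟩

/-! ### The joint law and the limit covariance -/

section JointLaw

variable {Ω : Type*} [MeasurableSpace Ω] {P : Measure Ω} [IsProbabilityMeasure P] {p : ℕ}
  {A : Ω → Fin p → ℤˣ} {B : Ω → ℤˣ} {β : PowerIndex p → ℝ}

lemma integrable_comp_discrete {κ : Type*} [Finite κ] [MeasurableSpace κ]
    [DiscreteMeasurableSpace κ] {X : Ω → κ} (hX : Measurable X) (F : κ → ℝ) :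
    Integrable (fun ω => F (X ω)) P := by
  obtain ⟨C, hC⟩ := Set.Finite.bddAbove (Set.finite_range fun k => ‖F k‖)
  exact Integrable.of_bound ((Measurable.of_discrete (f := F)).comp hX).aestronglyMeasurable C
    (ae_of_all _ fun ω => hC ⟨X ω, rfl⟩)

/-- The cell is an event of the conditioning σ-algebra, and the conditional expectation is almost
surely constant on it. -/
lemma setIntegral_sgn (hA : Measurable A) (hB : Measurable B) (hβ : IsSlopeVector P A B β)
    (v : Fin p → ℤˣ) :
    ∫ ω in {ω | A ω = v}, sgn (B ω) ∂P = P.real {ω | A ω = v} * (β ⬝ᵥ powerVec v) := by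
  have hs : MeasurableSet[MeasurableSpace.comap A inferInstance] {ω | A ω = v} :=
    ⟨{v}, measurableSet_singleton v, rfl⟩
  rw [← setIntegral_condExp hA.comap_le (integrable_comp_discrete hB sgn) hs,
    setIntegral_congr_ae (s := {ω | A ω = v}) (hA (measurableSet_singleton v)) (g := fun _ => β ⬝ᵥ powerVec v)]
  · simp
  · filter_upwards [hβ] with ω hω hv
    rw [hω, hv]

/-- The slopes and the marginal law of the predictors determine the joint law. -/
lemma measureReal_eq_jointProb (hA : Measurable A) (hB : Measurable B)
    (hβ : IsSlopeVector P A B β) (r : ℤˣ) (v : Fin p → ℤˣ) :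
    P.real {ω | (B ω, A ω) = (r, v)} = jointProb (fun v => P.real {ω | A ω = v}) β r v := by
  have hm : MeasurableSet {ω | B ω = r} := hB (measurableSet_singleton r)
  have h1 : P.real {ω | (B ω, A ω) = (r, v)} =
      ∫ ω in {ω | A ω = v}, (1 + sgn r * sgn (B ω)) / 2 ∂P := by
    have h2 : ∀ ω, (1 + sgn r * sgn (B ω)) / 2 = {ω | B ω = r}.indicator 1 ω := by
      intro ω
      by_cases h : B ω = r
      · rw [Set.indicator_of_mem (by exact h), h, sgn_mul_self]
        norm_num
      · rw [Set.indicator_of_notMem (by exact h)]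
        rcases Int.units_eq_one_or r with rfl | rfl <;>
          rcases Int.units_eq_one_or (B ω) with hy | hy <;> simp_all [sgn]
    simp_rw [h2]
    rw [integral_indicator_one hm, measureReal_restrict_apply hm]
    congr 1
    ext ω
    simp
  rw [h1, integral_div, integral_add (integrable_const _)
    ((integrable_comp_discrete hB sgn).integrableOn.const_mul _), integral_const_mul,
    setIntegral_sgn hA hB hβ]
  simp [jointProb]
  ring

lemma integral_eq_sum_jointProb (hA : Measurable A) (hB : Measurable B)
    (hβ : IsSlopeVector P A B β) (F : ℤˣ × (Fin p → ℤˣ) → ℝ) :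
    ∫ ω, F (B ω, A ω) ∂P = ∑ v, (jointProb (fun v => P.real {ω | A ω = v}) β 1 v * F (1, v) +
      jointProb (fun v => P.real {ω | A ω = v}) β (-1) v * F (-1, v)) := by
  have hX : Measurable fun ω => (B ω, A ω) := hB.prodMk hA
  have : IsProbabilityMeasure (P.map fun ω => (B ω, A ω)) :=
    Measure.isProbabilityMeasure_map hX.aemeasurable
  rw [← integral_map (φ := fun ω => (B ω, A ω)) (f := F) hX.aemeasurable
    (Measurable.of_discrete (f := F)).aestronglyMeasurable,
    integral_fintype (f := F) (integrable_comp_discrete measurable_id F), Fintype.sum_prod_type,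
    sum_units_int, ← Finset.sum_add_distrib]
  refine Finset.sum_congr rfl fun v _ => ?_
  rw [map_measureReal_apply hX (measurableSet_singleton _),
    map_measureReal_apply hX (measurableSet_singleton _)]
  simp only [← measureReal_eq_jointProb hA hB hβ]
  rfl

/-- If cell `v` were null, adding `powerVec v` to `β` would change the regression function only on
that cell, against uniqueness. -/
lemma measureReal_cell_pos (hβ : IsSlopeVector P A B β)
    (hunique : ∀ b, IsSlopeVector P A B b → b = β) (v : Fin p → ℤˣ) :
    0 < P.real {ω | A ω = v} := by
  refine measureReal_nonneg.lt_of_ne' fun h => ?_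
  have hne : ∀ᵐ ω ∂P, A ω ≠ v := by
    rw [ae_iff]
    simpa [measureReal_eq_zero_iff] using h
  have h1 : β + powerVec v = β := by
    refine hunique _ ?_
    filter_upwards [hβ, hne] with ω hω hv
    rw [hω, add_dotProduct, powerVec_dotProduct_powerVec, if_neg hv.symm, add_zero]
  have h2 := powerVec_dotProduct_powerVec v v
  rw [add_eq_left.1 h1, zero_dotProduct, if_pos rfl] at h2
  exact absurd h2 (by positivity)

lemma abs_slope_dotProduct_le (hA : Measurable A) (hB : Measurable B)
    (hβ : IsSlopeVector P A B β) {v : Fin p → ℤˣ} (hv : 0 < P.real {ω | A ω = v}) :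
    |β ⬝ᵥ powerVec v| ≤ 1 := by
  have h1 := measureReal_eq_jointProb hA hB hβ 1 v ▸ measureReal_nonneg
  have h2 := measureReal_eq_jointProb hA hB hβ (-1) v ▸ measureReal_nonneg
  have h1' := nonneg_of_mul_nonneg_right h1 hv
  have h2' := nonneg_of_mul_nonneg_right h2 hv
  rw [sgn_one] at h1'
  rw [sgn_neg_one] at h2'
  exact abs_le.2 ⟨by linarith, by linarith⟩

lemma cellVarMatrix_eq (P : Measure Ω) (A : Ω → Fin p → ℤˣ) (β : PowerIndex p → ℝ) :
    cellVarMatrix P A β = Matrix.diagonal fun s =>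
      (1 - (β ⬝ᵥ powerVec (rowEquiv p s)) ^ 2) / P.real {ω | A ω = rowEquiv p s} := by
  simp only [cellVarMatrix, sylvesterHadamard_row, powerVec_injective.eq_iff]

lemma asymptoticCov_posSemidef (hA : Measurable A) (hB : Measurable B)
    (hβ : IsSlopeVector P A B β) (hpos : ∀ v, 0 < P.real {ω | A ω = v}) :
    (asymptoticCov P A β).PosSemidef := by
  refine Matrix.PosSemidef.smul ?_ (by positivity)
  have hH : (sylvesterHadamard p)ᴴ = sylvesterHadamard p := by
    rw [conjTranspose_eq_transpose_of_trivial, sylvesterHadamard_transpose]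
  have hD : (cellVarMatrix P A β).PosSemidef := by
    rw [cellVarMatrix_eq]
    refine Matrix.PosSemidef.diagonal fun s => div_nonneg ?_ measureReal_nonneg
    have := (sq_le_one_iff_abs_le_one _).2 (abs_slope_dotProduct_le hA hB hβ (hpos (rowEquiv p s)))
    linarith
  simpa only [hH] using hD.mul_mul_conjTranspose_same (sylvesterHadamard p)

/-- Hadamard entries square to one, so every diagonal entry weighs the cells equally. -/
lemma asymptoticCov_diag (P : Measure Ω) (A : Ω → Fin p → ℤˣ) (β : PowerIndex p → ℝ)
    (s : PowerIndex p) :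
    asymptoticCov P A β s s = (cellVarMatrix P A β).trace / 2 ^ (2 * p) := by
  rw [asymptoticCov, cellVarMatrix, Matrix.smul_apply, Matrix.mul_apply, trace_diagonal, smul_eq_mul,
    one_div_mul_eq_div]
  congr 1
  refine Finset.sum_congr rfl fun t _ => ?_
  rw [mul_diagonal, mul_right_comm]
  nth_rw 2 [← sylvesterHadamard_transpose]
  rw [transpose_apply, sylvesterHadamard_mul_self, one_mul]

lemma dotProduct_asymptoticCov_mulVec (P : Measure Ω) (A : Ω → Fin p → ℤˣ)
    (β t : PowerIndex p → ℝ) :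
    t ⬝ᵥ asymptoticCov P A β *ᵥ t = ((2 : ℝ) ^ p)⁻¹ ^ 2 * ∑ v, (powerVec v ⬝ᵥ t) ^ 2 *
      ((1 - (β ⬝ᵥ powerVec v) ^ 2) / P.real {ω | A ω = v}) := by
  rw [asymptoticCov, smul_mulVec, dotProduct_smul, smul_eq_mul, ← mulVec_mulVec, ← mulVec_mulVec,
    dotProduct_mulVec, ← mulVec_transpose, sylvesterHadamard_transpose, cellVarMatrix_eq,
    ← (rowEquiv p).sum_comp]
  congr 1
  · rw [inv_pow, ← pow_mul, mul_comm p, one_div]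
  · rw [dotProduct]
    refine Finset.sum_congr rfl fun s _ => ?_
    rw [mulVec_diagonal]
    have : (sylvesterHadamard p *ᵥ t) s = powerVec (rowEquiv p s) ⬝ᵥ t := by
      rw [← sylvesterHadamard_row]
      rfl
    rw [this]
    ring

end JointLaw

/-! ### Consistency and asymptotic normality -/

section Asymptotics

variable {Ω : Type*} [MeasurableSpace Ω] {P : Measure Ω} {p : ℕ}
  {A : ℕ → Ω → Fin p → ℤˣ} {B : ℕ → Ω → ℤˣ} {β : PowerIndex p → ℝ}

lemma ae_tendsto_average (hA : ∀ i, Measurable (A i)) (hB : ∀ i, Measurable (B i))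
    (hindep : iIndepFun (fun i ω => (B i ω, A i ω)) P)
    (hident : ∀ i, IdentDistrib (fun ω => (B i ω, A i ω)) (fun ω => (B 0 ω, A 0 ω)) P P)
    [IsProbabilityMeasure P] (F : ℤˣ × (Fin p → ℤˣ) → ℝ) :
    ∀ᵐ ω ∂P, Tendsto (fun n : ℕ => (∑ i : Fin n, F (B i ω, A i ω)) / n) atTop
      (𝓝 (∫ ω, F (B 0 ω, A 0 ω) ∂P)) := by
  have hF : Measurable F := .of_discrete
  filter_upwards [strong_law_ae_real (fun i ω => F (B i ω, A i ω))
    (integrable_comp_discrete ((hB 0).prodMk (hA 0)) F)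
    (fun i j hij => (hindep.comp (fun _ => F) fun _ => hF).indepFun hij)
    (fun i => (hident i).comp hF)] with ω hω
  simpa only [Finset.sum_range] using hω

lemma ae_tendsto_cellCount_div [IsProbabilityMeasure P] (hA : ∀ i, Measurable (A i))
    (hB : ∀ i, Measurable (B i)) (hindep : iIndepFun (fun i ω => (B i ω, A i ω)) P)
    (hident : ∀ i, IdentDistrib (fun ω => (B i ω, A i ω)) (fun ω => (B 0 ω, A 0 ω)) P P) :
    ∀ᵐ ω ∂P, ∀ v, Tendsto (fun n : ℕ => cellCount (fun i : Fin n => A i ω) v / n) atTop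
      (𝓝 (P.real {ω | A 0 ω = v})) := by
  refine ae_all_iff.2 fun v => ?_
  have h := ae_tendsto_average hA hB hindep hident fun x => if x.2 = v then 1 else 0
  have h1 : ∫ ω, (if A 0 ω = v then (1 : ℝ) else 0) ∂P = P.real {ω | A 0 ω = v} := by
    rw [← integral_indicator_one (show MeasurableSet {ω | A 0 ω = v} from
      hA 0 (measurableSet_singleton v))]
    simp [Set.indicator_apply]
  rwa [h1] at h

lemma ae_tendsto_cellSum_div [IsProbabilityMeasure P] (hA : ∀ i, Measurable (A i))
    (hB : ∀ i, Measurable (B i)) (hindep : iIndepFun (fun i ω => (B i ω, A i ω)) P)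
    (hident : ∀ i, IdentDistrib (fun ω => (B i ω, A i ω)) (fun ω => (B 0 ω, A 0 ω)) P P)
    (hβ : IsSlopeVector P (A 0) (B 0) β) :
    ∀ᵐ ω ∂P, ∀ v, Tendsto
      (fun n : ℕ => cellSum (fun i : Fin n => A i ω) (fun i : Fin n => B i ω) v / n) atTop
      (𝓝 (P.real {ω | A 0 ω = v} * (β ⬝ᵥ powerVec v))) := by
  refine ae_all_iff.2 fun v => ?_
  have h := ae_tendsto_average hA hB hindep hident fun x => if x.2 = v then sgn x.1 else 0
  have h1 : ∫ ω, (if A 0 ω = v then sgn (B 0 ω) else 0) ∂P =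
      P.real {ω | A 0 ω = v} * (β ⬝ᵥ powerVec v) := by
    rw [← setIntegral_sgn (hA 0) (hB 0) hβ,
      ← integral_indicator (show MeasurableSet {ω | A 0 ω = v} from
        hA 0 (measurableSet_singleton v))]
    simp [Set.indicator_apply]
  rwa [h1] at h

lemma eventually_lseExists {a : ℕ → Fin p → ℤˣ} {q : (Fin p → ℤˣ) → ℝ} (hq : ∀ v, 0 < q v)
    (h : ∀ v, Tendsto (fun n : ℕ => cellCount (fun i : Fin n => a i) v / n) atTop (𝓝 (q v))) :
    ∀ᶠ n : ℕ in atTop, LSEExists fun i : Fin n => a i := by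
  simp only [lseExists_iff]
  refine eventually_all.2 fun v => ?_
  filter_upwards [(h v).eventually (lt_mem_nhds (hq v))] with n hn
  exact (cellCount_nonneg _ v).lt_of_ne' fun h0 => by simp [h0] at hn

lemma leastSquares_dotProduct {n : ℕ} {a : Fin n → Fin p → ℤˣ} (ha : LSEExists a)
    (y : Fin n → ℤˣ) (v : Fin p → ℤˣ) :
    leastSquares a y ⬝ᵥ powerVec v = cellSum a y v / cellCount a v := by
  rw [eq_div_iff ((lseExists_iff a).1 ha v).ne', mul_comm, cellCount_mul_leastSquares ha]

lemma tendsto_leastSquares {a : ℕ → Fin p → ℤˣ} {y : ℕ → ℤˣ} {q : (Fin p → ℤˣ) → ℝ}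
    (hq : ∀ v, 0 < q v)
    (h : ∀ v, Tendsto (fun n : ℕ => cellCount (fun i : Fin n => a i) v / n) atTop (𝓝 (q v)))
    (h' : ∀ v, Tendsto (fun n : ℕ => cellSum (fun i : Fin n => a i) (fun i : Fin n => y i) v / n)
      atTop (𝓝 (q v * (β ⬝ᵥ powerVec v)))) :
    Tendsto (fun n : ℕ => leastSquares (fun i : Fin n => a i) (fun i : Fin n => y i)) atTop
      (𝓝 β) := by
  have hcell : ∀ v, Tendsto (fun n : ℕ =>
      leastSquares (fun i : Fin n => a i) (fun i : Fin n => y i) ⬝ᵥ powerVec v) atTop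
      (𝓝 (β ⬝ᵥ powerVec v)) := by
    intro v
    have h1 := (h' v).div (h v) (hq v).ne'
    rw [mul_div_cancel_left₀ _ (hq v).ne'] at h1
    refine h1.congr' ?_
    filter_upwards [eventually_lseExists hq h] with n hn
    have hn0 : (n : ℝ) ≠ 0 := Nat.cast_ne_zero.2 (pos_of_lseExists hn).ne'
    rw [Pi.div_apply, leastSquares_dotProduct hn, div_div_div_cancel_right₀ hn0]
  have h2 := (tendsto_finsetSum Finset.univ fun v _ =>
    (hcell v).smul_const (powerVec v)).const_smul ((2 : ℝ) ^ p)⁻¹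
  simpa only [sum_dotProduct_smul_powerVec] using h2

/-- The contribution of an observation to the linearization of the least-squares estimator. -/
def influence (q : (Fin p → ℤˣ) → ℝ) (β : PowerIndex p → ℝ) (x : ℤˣ × (Fin p → ℤˣ)) :
    EuclideanSpace ℝ (PowerIndex p) :=
  WithLp.toLp 2 ((((2 : ℝ) ^ p)⁻¹ * ((sgn x.1 - β ⬝ᵥ powerVec x.2) / q x.2)) • powerVec x.2)

lemma inner_influence (q : (Fin p → ℤˣ) → ℝ) (β : PowerIndex p → ℝ) (x : ℤˣ × (Fin p → ℤˣ))
    (t : EuclideanSpace ℝ (PowerIndex p)) :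
    inner ℝ (influence q β x) t = (((2 : ℝ) ^ p)⁻¹ * ((sgn x.1 - β ⬝ᵥ powerVec x.2) / q x.2)) *
      (powerVec x.2 ⬝ᵥ t) := by
  rw [EuclideanSpace.inner_eq_star_dotProduct, influence]
  simp only [star_trivial, dotProduct_smul, smul_eq_mul]
  rw [dotProduct_comm t.ofLp]

lemma tendstoInDistribution_sum_influence [IsProbabilityMeasure P] (hA : ∀ i, Measurable (A i))
    (hB : ∀ i, Measurable (B i)) (hindep : iIndepFun (fun i ω => (B i ω, A i ω)) P)
    (hident : ∀ i, IdentDistrib (fun ω => (B i ω, A i ω)) (fun ω => (B 0 ω, A 0 ω)) P P)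
    (hβ : IsSlopeVector P (A 0) (B 0) β) (hpos : ∀ v, 0 < P.real {ω | A 0 ω = v}) :
    TendstoInDistribution
      (fun (n : ℕ) ω => (√(n : ℝ))⁻¹ • ∑ k ∈ Finset.range n,
        influence (fun v => P.real {ω | A 0 ω = v}) β (B k ω, A k ω))
      atTop id (fun _ => P) (multivariateGaussian 0 (asymptoticCov P (A 0) β)) := by
  set q : (Fin p → ℤˣ) → ℝ := fun v => P.real {ω | A 0 ω = v} with hq
  have hW : Measurable (influence q β) := .of_discrete
  refine tendstoInDistribution_multivariateGaussian
    (X := fun k ω => influence q β (B k ω, A k ω))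
    (hindep.comp (fun _ => influence q β) fun _ => hW) (fun i => (hident i).comp hW) ?_
    (asymptoticCov_posSemidef (hA 0) (hB 0) hβ hpos) ?_ ?_
  · obtain ⟨C, hC⟩ := Set.Finite.bddAbove (Set.finite_range fun k => ‖influence q β k‖)
    exact MemLp.of_bound (hW.comp ((hB 0).prodMk (hA 0))).aestronglyMeasurable C
      (ae_of_all _ fun ω => hC ⟨_, rfl⟩)
  · intro t
    rw [integral_eq_sum_jointProb (hA 0) (hB 0) hβ (fun x => inner ℝ (influence q β x) t)]
    refine Finset.sum_eq_zero fun v _ => ?_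
    -- With cell mean `m`, the centered response averages to `(1 + m) / 2 * (1 - m) + (1 - m) / 2 *
    -- (-1 - m) = 0`.
    simp only [inner_influence, jointProb, sgn_one, sgn_neg_one]
    ring
  · intro t
    rw [integral_eq_sum_jointProb (hA 0) (hB 0) hβ (fun x => inner ℝ (influence q β x) t ^ 2),
      dotProduct_asymptoticCov_mulVec, Finset.mul_sum]
    -- The response variance in the cell is `1 - m ^ 2`; the influence divides by `q v`, and
    -- squaring leaves one factor `1 / q v` after weighting by the cell probability.
    refine Finset.sum_congr rfl fun v _ => ?_
    have hv : q v ≠ 0 := (hpos v).ne'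
    simp only [inner_influence, jointProb, sgn_one, sgn_neg_one]
    rw [show P.real {ω | A 0 ω = v} = q v from rfl]
    field_simp
    ring

/-- Rescales the fitted value in each cell `v` by `r v`. -/
def cellRescale (x : EuclideanSpace ℝ (PowerIndex p) × ((Fin p → ℤˣ) → ℝ)) :
    EuclideanSpace ℝ (PowerIndex p) :=
  WithLp.toLp 2 (((2 : ℝ) ^ p)⁻¹ • ∑ v, (x.2 v * (x.1.ofLp ⬝ᵥ powerVec v)) • powerVec v)

lemma continuous_cellRescale : Continuous (cellRescale (p := p)) := by
  unfold cellRescale dotProduct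
  fun_prop

lemma cellRescale_one (x : EuclideanSpace ℝ (PowerIndex p)) : cellRescale (x, 1) = x := by
  simp [cellRescale, sum_dotProduct_smul_powerVec]

lemma sum_influence_dotProduct {n : ℕ} {q : (Fin p → ℤˣ) → ℝ} (β : PowerIndex p → ℝ)
    (a : Fin n → Fin p → ℤˣ) (y : Fin n → ℤˣ) (v : Fin p → ℤˣ) :
    (∑ i, influence q β (y i, a i)).ofLp ⬝ᵥ powerVec v =
      (cellSum a y v - cellCount a v * (β ⬝ᵥ powerVec v)) / q v := by
  simp only [WithLp.ofLp_sum, sum_dotProduct, influence, smul_dotProduct,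
    powerVec_dotProduct_powerVec, cellSum, cellCount, Finset.sum_mul, ← Finset.sum_sub_distrib,
    Finset.sum_div, smul_eq_mul]
  refine Finset.sum_congr rfl fun i _ => ?_
  split_ifs with h
  · rw [h]
    field_simp
  · simp

/-- An exact identity: the influence sum normalizes cell `v` by `q v`, the estimator by the observed
frequency, and the rescaling exchanges one for the other. -/
lemma sqrt_smul_leastSquares_sub {n : ℕ} {a : Fin n → Fin p → ℤˣ} (ha : LSEExists a)
    (y : Fin n → ℤˣ) {q : (Fin p → ℤˣ) → ℝ} (hq : ∀ v, q v ≠ 0) (β : PowerIndex p → ℝ) :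
    WithLp.toLp 2 (√(n : ℝ) • (leastSquares a y - β)) =
      cellRescale ((√(n : ℝ))⁻¹ • ∑ i, influence q β (y i, a i),
        fun v => q v / (cellCount a v / n)) := by
  rw [cellRescale]
  congr 1
  refine ext_dotProduct_powerVec fun v => ?_
  have hn : (0 : ℝ) < n := Nat.cast_pos.2 (pos_of_lseExists ha)
  have hs : √(n : ℝ) ≠ 0 := (Real.sqrt_pos.2 hn).ne'
  have hc : cellCount a v ≠ 0 := ((lseExists_iff a).1 ha v).ne'
  rw [smul_dotProduct, sub_dotProduct, leastSquares_dotProduct ha, smul_dotProduct,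
    dotProduct_sum_smul_powerVec, WithLp.ofLp_smul, smul_dotProduct, sum_influence_dotProduct]
  have hv := hq v
  simp only [smul_eq_mul]
  field_simp
  rw [Real.sq_sqrt hn.le, mul_comm]

lemma measurable_cellCount (hA : ∀ i, Measurable (A i)) (n : ℕ) (v : Fin p → ℤˣ) :
    Measurable fun ω => cellCount (fun i : Fin n => A i ω) v :=
  Finset.measurable_fun_sum _ fun i _ =>
    Measurable.ite (hA i (measurableSet_singleton v)) measurable_const measurable_const

lemma tendstoInDistribution_sqrt_smul_sub [IsProbabilityMeasure P] (hA : ∀ i, Measurable (A i))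
    (hB : ∀ i, Measurable (B i)) (hindep : iIndepFun (fun i ω => (B i ω, A i ω)) P)
    (hident : ∀ i, IdentDistrib (fun ω => (B i ω, A i ω)) (fun ω => (B 0 ω, A 0 ω)) P P)
    (hβ : IsSlopeVector P (A 0) (B 0) β) (hpos : ∀ v, 0 < P.real {ω | A 0 ω = v})
    {βhat : ℕ → Ω → PowerIndex p → ℝ} (hβhat_meas : ∀ n, AEMeasurable (βhat n) P)
    (hβhat : ∀ n ω, LSEExists (fun i : Fin n => A i ω) →
      βhat n ω = leastSquares (fun i : Fin n => A i ω) (fun i : Fin n => B i ω)) :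
    TendstoInDistribution
      (fun (n : ℕ) ω => (WithLp.toLp 2 (√(n : ℝ) • (βhat n ω - β)) :
        EuclideanSpace ℝ (PowerIndex p)))
      atTop id (fun _ => P) (multivariateGaussian 0 (asymptoticCov P (A 0) β)) := by
  set q : (Fin p → ℤˣ) → ℝ := fun v => P.real {ω | A 0 ω = v} with hq
  have hS := tendstoInDistribution_sum_influence hA hB hindep hident hβ hpos
  rw [← hq] at hS
  set S : ℕ → Ω → EuclideanSpace ℝ (PowerIndex p) := fun n ω =>
    (√(n : ℝ))⁻¹ • ∑ k ∈ Finset.range n, influence q β (B k ω, A k ω) with hSdef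
  set R : ℕ → Ω → (Fin p → ℤˣ) → ℝ := fun n ω v =>
    q v / (cellCount (fun i : Fin n => A i ω) v / n) with hRdef
  have hcount := ae_tendsto_cellCount_div hA hB hindep hident
  have hR : ∀ n, Measurable (R n) := fun n => measurable_pi_iff.2 fun v =>
    ((measurable_cellCount hA n v).div_const _).const_div _
  have hR1 : ∀ᵐ ω ∂P, Tendsto (fun n => R n ω) atTop (𝓝 1) := by
    filter_upwards [hcount] with ω hω
    refine tendsto_pi_nhds.2 fun v => ?_
    have h := (tendsto_const_nhds (x := q v)).div (hω v) (hpos v).ne'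
    rwa [div_self (hpos v).ne'] at h
  have hg := hS.continuous_comp_prodMk_of_tendstoInMeasure_const continuous_cellRescale
    (tendstoInMeasure_of_tendsto_ae (g := fun _ => 1)
      (fun n => (hR n).aestronglyMeasurable) hR1) fun n => (hR n).aemeasurable
  have hgm := hg.forall_aemeasurable
  have hm : ∀ n : ℕ, AEMeasurable (fun ω => (WithLp.toLp 2 (√(n : ℝ) • (βhat n ω - β)) :
      EuclideanSpace ℝ (PowerIndex p))) P := fun n =>
    (PiLp.continuous_toLp 2 _).measurable.comp_aemeasurable
      (((hβhat_meas n).sub_const β).fun_const_smul _)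
  -- Almost surely the difference is eventually exactly zero, so the arbitrary values of `βhat` do
  -- not affect the limit.
  have hzero : ∀ᵐ ω ∂P, Tendsto (fun n : ℕ => WithLp.toLp 2 (√(n : ℝ) • (βhat n ω - β)) -
      cellRescale (S n ω, R n ω)) atTop (𝓝 0) := by
    filter_upwards [hcount] with ω hω
    refine tendsto_const_nhds.congr' ?_
    filter_upwards [eventually_lseExists (a := fun i => A i ω) hpos hω] with n hn
    rw [hβhat n ω hn, sqrt_smul_leastSquares_sub hn _ (fun v => (hpos v).ne') β, hSdef]
    simp only [Finset.sum_range]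
    exact (sub_self _).symm
  have h := tendstoInDistribution_of_tendstoInMeasure_sub
    (fun (n : ℕ) ω => (WithLp.toLp 2 (√(n : ℝ) • (βhat n ω - β)) :
      EuclideanSpace ℝ (PowerIndex p))) _ hg
    (tendstoInMeasure_of_tendsto_ae
      (fun n => ((hm n).sub (hgm n)).aestronglyMeasurable) hzero) hm
  exact h.congr (fun _ => .rfl) (ae_of_all _ cellRescale_one)

end Asymptotics

end

theorem theorem8 {Ω : Type*} [MeasurableSpace Ω] (P : Measure Ω) [IsProbabilityMeasure P]
    (p : ℕ) (A : ℕ → Ω → Fin p → ℤˣ) (B : ℕ → Ω → ℤˣ)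
    (hA : ∀ i, Measurable (A i)) (hB : ∀ i, Measurable (B i))
    (hindep : iIndepFun (fun i ω => (B i ω, A i ω)) P)
    (hident : ∀ i, IdentDistrib (fun ω => (B i ω, A i ω)) (fun ω => (B 0 ω, A 0 ω)) P P)
    (hlt : ∀ᵐ ω ∂P,
      |(P[fun ω => sgn (B 0 ω) | MeasurableSpace.comap (A 0) inferInstance]) ω| < 1)
    (β : PowerIndex p → ℝ)
    (hβ : IsSlopeVector P (A 0) (B 0) β)
    (hβ_unique : ∀ b, IsSlopeVector P (A 0) (B 0) b → b = β)
    -- `βhat n` is the least-squares estimator from the first `n` observations whenever it exists;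
    -- its values elsewhere are arbitrary.
    (βhat : ℕ → Ω → PowerIndex p → ℝ)
    (hβhat_meas : ∀ n, AEMeasurable (βhat n) P)
    (hβhat : ∀ n ω, LSEExists (fun i : Fin n => A i ω) →
      βhat n ω = leastSquares (fun i : Fin n => A i ω) (fun i : Fin n => B i ω)) :
    (∀ n ω, LSEExists (fun i : Fin n => A i ω) →
      (∀ b, IsMLE (fun i : Fin n => A i ω) (fun i : Fin n => B i ω) b ↔ b = βhat n ω) ∧
      (∀ b, IsMLEKnownMarginal (fun v => P.real {ω' | A 0 ω' = v})
        (fun i : Fin n => A i ω) (fun i : Fin n => B i ω) b ↔ b = βhat n ω)) ∧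
    (∀ᵐ ω ∂P, (∀ᶠ n in atTop, LSEExists (fun i : Fin n => A i ω)) ∧
      Tendsto (fun n => βhat n ω) atTop (𝓝 β)) ∧
    (asymptoticCov P (A 0) β).PosSemidef ∧
    TendstoInDistribution
      (fun (n : ℕ) ω => (WithLp.toLp 2 (√(n : ℝ) • (βhat n ω - β)) :
        EuclideanSpace ℝ (PowerIndex p)))
      atTop id (fun _ => P) (multivariateGaussian 0 (asymptoticCov P (A 0) β)) ∧
    (∀ s, Var[fun x : EuclideanSpace ℝ (PowerIndex p) => x s;
        multivariateGaussian 0 (asymptoticCov P (A 0) β)]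
      = (cellVarMatrix P (A 0) β).trace / 2 ^ (2 * p)) := by
  have hpos := measureReal_cell_pos hβ hβ_unique
  have hcov := asymptoticCov_posSemidef (hA 0) (hB 0) hβ hpos
  refine ⟨fun n ω hex => ?_, ?_, hcov,
    tendstoInDistribution_sqrt_smul_sub hA hB hindep hident hβ hpos hβhat_meas hβhat, fun s => ?_⟩
  · rw [hβhat n ω hex]
    exact ⟨isMLE_iff hex _, isMLEKnownMarginal_iff hpos hex _⟩
  · filter_upwards [ae_tendsto_cellCount_div hA hB hindep hident,
      ae_tendsto_cellSum_div hA hB hindep hident hβ] with ω h h'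
    have hex := eventually_lseExists (a := fun i => A i ω) hpos h
    refine ⟨hex, (tendsto_leastSquares (a := fun i => A i ω) (y := fun i => B i ω) hpos h h').congr' ?_⟩
    filter_upwards [hex] with n hn using (hβhat n ω hn).symm
  · rw [variance_eval_multivariateGaussian hcov, asymptoticCov_diag]
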